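/- Let $E$ be an $n$-dimensional Euclidean space, $L:E\to E$ a linear operator, $\Gamma_0\subset E$ a lattice of rank $n$, and $F$ a smooth ($C^\infty$) vector field on the closed unit ball of $E$. Let $G=E\rtimes\mathbb R$ be the Lie group with the multiplication $(w,u)(w',u')=(w+e^{uL}w',u+u')$, let $M=\Gamma_0\backslash G=(E/\Gamma_0)\times\mathbb R$, and let $SM=M\times\mathbb S^n$, $\mathbb S^n=\{(\xi,\eta)\in E\times\mathbb R:|\xi|^2+\eta^2=1\}$, be its unit sphere bundle, trivialized by left translations. The $L$-$F$ system is the flow on $SM$ defined by the equations $$\frac{d\xi}{dt}=\eta F(\xi),\quad \frac{d\eta}{dt}=-\langle F(\xi),\xi\rangle,\quad \frac{dw}{dt}=e^{uL}\xi,\quad \frac{du}{dt}=\eta .$$ A point $\zeta_0$ of the open unit ball $B\subset E$ is called escaping if there are real numbers $s_-\le 0\le s_+$ and an integral curve $\zeta:[s_-,s_+]\to E$ of $F$ with $\zeta(0)=\zeta_0$, $\zeta(s)\in B$ for $s_-<s<s_+$, $|\zeta(s_\pm)|=1$, $\langle F(\zeta(s_-)),\zeta(s_-)\rangle<0$ and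 $\langle F(\zeta(s_+)),\zeta(s_+)\rangle>0$. By an invariant torus carrying quasi-periodic motions we mean a smoothly embedded $(n+1)$-dimensional torus in $SM$ on which the flow is smoothly conjugate to a linear flow $\theta\mapsto\theta+t\omega$ on $\mathbb R^{n+1}/\mathbb Z^{n+1}$ for some $\omega\neq0$, whose components may be rationally dependent and which may depend on the torus. **Theorem.** The equations define a unique flow on $SM$, and: 1. If $F$ has an escaping point, then the $L$-$F$ system on $SM$ is semi-integrable: some non-empty open subset of $SM$ is a disjoint union of $(n+1)$-dimensional invariant tori carrying quasi-periodic motions. 2. If the escaping points of $F$ are dense in $B$, then the $L$-$F$ system on $SM$ is integrable: some open and dense subset of $SM$ is a disjoint union of $(n+1)$-dimensional invariant tori carrying quasi-periodic motions. -/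

import Mathlib

open scoped ContDiff

noncomputable section

namespace LF

/-- The unit sphere `Sⁿ = {(ξ, η) | ‖ξ‖² + η² = 1}` of the Lie algebra `𝔤 = 𝔤₀ ⊕ ℝ b`, where
`E = 𝔤₀` is an `n`-dimensional Euclidean space. -/
abbrev UnitSphere (E : Type*) [NormedAddCommGroup E] : Type _ :=
  {v : E × ℝ // ‖v.1‖ ^ 2 + v.2 ^ 2 = 1}

/-- The unit sphere bundle `SG` of the group `G = E ⋊ ℝ`, whose law is
`(w, u) * (w', u') = (w + e^{uL} w', u + u')`, trivialized by left translations: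
`SG = G × Sⁿ`, in the coordinates `(w, u; ξ, η)`. -/
abbrev SG (E : Type*) [NormedAddCommGroup E] : Type _ := E × ℝ × UnitSphere E

/-- The unit sphere bundle `SM = M × Sⁿ` of `M = Γ₀ \ G = (E / Γ₀) × ℝ`. The elements of the
lattice `Γ₀ ⊆ E` act on `G` on the left by `γ * (w, u) = (w + γ, u)`, and trivially on the
second factor of the trivialization `SG = G × Sⁿ`. -/
abbrev SM {E : Type*} [NormedAddCommGroup E] (Γ₀ : Submodule ℤ E) : Type _ :=
  (E ⧸ Γ₀.toAddSubgroup) × ℝ × UnitSphere E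

/-- The covering map `SG → SM`. -/
def proj {E : Type*} [NormedAddCommGroup E] (Γ₀ : Submodule ℤ E) (p : SG E) : SM Γ₀ :=
  (QuotientAddGroup.mk p.1, p.2.1, p.2.2)

/-- The fibres of the covering map `SG → SM` are the orbits of left translation by `Γ₀`. -/
theorem proj_eq_iff {E : Type*} [NormedAddCommGroup E] (Γ₀ : Submodule ℤ E) (p q : SG E) :
    proj Γ₀ p = proj Γ₀ q ↔ ∃ γ ∈ Γ₀, q = (p.1 + γ, p.2) := by
  obtain ⟨w, u, v⟩ := p
  obtain ⟨w', u', v'⟩ := q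
  simp only [proj, Prod.mk.injEq, QuotientAddGroup.eq]
  constructor
  · rintro ⟨h, rfl, rfl⟩
    exact ⟨-w + w', h, by simp⟩
  · rintro ⟨γ, h, rfl, rfl, rfl⟩
    simpa using h

/-- The curve `c(t) = (w(t), u(t); ξ(t), η(t))` in `SG` is a solution, defined for all times, of
`ξ' = η F(ξ)`, `η' = -⟨F(ξ), ξ⟩`, `w' = e^{uL} ξ`, `u' = η`. -/
structure IsSolution {E : Type*} [NormedAddCommGroup E] [InnerProductSpace ℝ E]
    (L : E →L[ℝ] E) (F : E → E) (c : ℝ → SG E) : Prop where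
  deriv_xi : ∀ t, HasDerivAt (fun s => (c s).2.2.1.1)
    ((c t).2.2.1.2 • F (c t).2.2.1.1) t
  deriv_eta : ∀ t, HasDerivAt (fun s => (c s).2.2.1.2)
    (-inner ℝ (F (c t).2.2.1.1) (c t).2.2.1.1) t
  deriv_w : ∀ t, HasDerivAt (fun s => (c s).1)
    (NormedSpace.exp ((c t).2.1 • L) (c t).2.2.1.1) t
  deriv_u : ∀ t, HasDerivAt (fun s => (c s).2.1) (c t).2.2.1.2 t

/-- The flow `Ψ` is the `L-F` system on `SM`: its orbits are the projections of the solutions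
in `SG`. -/
def IsLFSystem {E : Type*} [NormedAddCommGroup E] [InnerProductSpace ℝ E]
    {Γ₀ : Submodule ℤ E} (L : E →L[ℝ] E) (F : E → E) (Ψ : Flow ℝ (SM Γ₀)) : Prop :=
  ∀ p : SG E, ∃ c : ℝ → SG E, IsSolution L F c ∧ c 0 = p ∧
    ∀ t, Ψ t (proj Γ₀ p) = proj Γ₀ (c t)

/-- Escaping points of a vector field on the closed unit ball. -/
def IsEscaping {E : Type*} [NormedAddCommGroup E] [InnerProductSpace ℝ E]
    (F : E → E) (ζ₀ : E) : Prop :=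
  ζ₀ ∈ Metric.ball (0 : E) 1 ∧
  ∃ (a b : ℝ) (ζ : ℝ → E),
    (0 : ℝ) ∈ Set.Icc a b ∧ ζ 0 = ζ₀ ∧
    (∀ s ∈ Set.Icc a b, HasDerivWithinAt ζ (F (ζ s)) (Set.Icc a b) s) ∧
    (∀ s ∈ Set.Ioo a b, ζ s ∈ Metric.ball (0 : E) 1) ∧
    ζ a ∈ Metric.sphere (0 : E) 1 ∧ ζ b ∈ Metric.sphere (0 : E) 1 ∧
    inner ℝ (F (ζ a)) (ζ a) < 0 ∧ 0 < inner ℝ (F (ζ b)) (ζ b)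

/-- The torus `𝕋ᵏ = (ℝ / ℤ)ᵏ`. -/
abbrev Torus (k : ℕ) : Type := Fin k → UnitAddCircle

/-- The covering map `ℝᵏ → 𝕋ᵏ`. -/
def toTorus {k : ℕ} (x : Fin k → ℝ) : Torus k := fun i => (x i : UnitAddCircle)

/-- `φ : 𝕋ᵏ → SM` is a smooth embedding: a topological embedding which is a smooth immersion.
The latter is expressed by means of a lift `c : ℝᵏ → SG ⊆ E × ℝ × (E × ℝ)` of `φ` to the
covering spaces. -/
def IsSmoothEmbedding {E : Type*} [NormedAddCommGroup E] [InnerProductSpace ℝ E] {k : ℕ}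
    {Γ₀ : Submodule ℤ E} (φ : Torus k → SM Γ₀) : Prop :=
  Topology.IsEmbedding φ ∧
  ∃ c : (Fin k → ℝ) → SG E,
    (∀ x, proj Γ₀ (c x) = φ (toTorus x)) ∧
    ContDiff ℝ ∞ (fun x => ((c x).1, (c x).2.1, (c x).2.2.1)) ∧
    ∀ x, Function.Injective
      (fderiv ℝ (fun y => ((c y).1, (c y).2.1, (c y).2.2.1)) x)

/-- `T` is a smoothly embedded `(n+1)`-dimensional invariant torus of the flow `Ψ`, `n = dim E`,
on which the motion is quasi-periodic, i.e. smoothly conjugate to a linear flow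
`θ ↦ θ + t • freq` on `𝕋ⁿ⁺¹`. As usual, the frequencies may be rationally dependent, but they do
not all vanish. -/
def IsQuasiPeriodicTorus {E : Type*} [NormedAddCommGroup E] [InnerProductSpace ℝ E]
    {Γ₀ : Submodule ℤ E} (Ψ : Flow ℝ (SM Γ₀)) (T : Set (SM Γ₀)) : Prop :=
  ∃ (φ : Torus (Module.finrank ℝ E + 1) → SM Γ₀) (freq : Fin (Module.finrank ℝ E + 1) → ℝ),
    IsSmoothEmbedding φ ∧ Set.range φ = T ∧ freq ≠ 0 ∧
    ∀ (t : ℝ) (θ : Torus (Module.finrank ℝ E + 1)), Ψ t (φ θ) = φ (θ + toTorus (t • freq))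

/-- `U` is filled with quasi-periodic tori: it is the disjoint union of a family of them. -/
def IsFilledWithTori {E : Type*} [NormedAddCommGroup E] [InnerProductSpace ℝ E]
    {Γ₀ : Submodule ℤ E} (Ψ : Flow ℝ (SM Γ₀)) (U : Set (SM Γ₀)) : Prop :=
  ∃ 𝒯 : Set (Set (SM Γ₀)),
    (∀ T ∈ 𝒯, IsQuasiPeriodicTorus Ψ T) ∧ 𝒯.PairwiseDisjoint id ∧ ⋃₀ 𝒯 = U

def SemiIntegrable {E : Type*} [NormedAddCommGroup E] [InnerProductSpace ℝ E]
    {Γ₀ : Submodule ℤ E} (Ψ : Flow ℝ (SM Γ₀)) : Prop :=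
  ∃ U : Set (SM Γ₀), IsOpen U ∧ U.Nonempty ∧ IsFilledWithTori Ψ U

def Integrable {E : Type*} [NormedAddCommGroup E] [InnerProductSpace ℝ E]
    {Γ₀ : Submodule ℤ E} (Ψ : Flow ℝ (SM Γ₀)) : Prop :=
  ∃ U : Set (SM Γ₀), IsOpen U ∧ Dense U ∧ IsFilledWithTori Ψ U

end LF

end

/-!
The argument rests on two observations about the base point `(u; ξ, η)` of a solution, which evolves
independently of `w`.

* The field `(ξ, η) ↦ (η F(ξ), -⟨F(ξ), ξ⟩)` is tangent to the compact sphere, hence complete, and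
  `u` and `w` are obtained by integration (`LF.exists_sphereFlow`, `LF.exists_solutions`). The right
  hand sides do not depend on `w`, so that the flow descends to `SM`.
* The system is reversible under `(w, u; ξ, η) ↦ (-w, u; ξ, -η)`. A base point with `η = 0` is fixed
  by this reflection, so the orbit of the base point is symmetric about each zero of `η`, and two
  distinct zeros of `η` make it periodic (`LF.IsSolution.snd_periodic`).

Call a solution oscillating if `η` changes its sign at least twice. The orbit of the base point is
then a simple closed curve with a minimal period `T` (`LF.Oscillates.exists_period`), and `w` is
translated by a fixed vector `Ω` in each period. The product of `E / Γ₀` with that curve is the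
desired torus: the motion is linear in the coordinates `t / T` and `w - w(t) + (t / T) Ω`
(`LF.Oscillates.isQuasiPeriodicTorus`). The set of points on oscillating orbits is open by the
continuity of the flow, and it is the disjoint union of these tori.

It remains to see that the orbit of `(ξ, η)` oscillates if `ξ` is an escaping point
(`LF.IsSolution.oscillates`). Along the integral curve `ζ` of `F` through `ξ`, one has
`ξ(t) = ζ(s(t))` with `s' = η` and `s'² = 1 - ‖ζ(s)‖²`. This is the motion of a particle in a
potential well whose turning points are the parameters at which `ζ` meets the unit sphere; as `ζ`
crosses the sphere transversally there, the particle turns back in finite time at both of them.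
-/

/-! ### Global flows of bounded Lipschitz vector fields -/

open Set Filter Metric in
/-- A bounded, globally Lipschitz vector field on a Banach space is complete and its flow is
jointly continuous. -/
theorem LipschitzWith.exists_global_flow {V : Type*} [NormedAddCommGroup V] [NormedSpace ℝ V]
    [CompleteSpace V] {Z : V → V} {K : NNReal} (hZ : LipschitzWith K Z) {C : NNReal}
    (hC : ∀ x, ‖Z x‖ ≤ C) :
    ∃ Φ : V × ℝ → V, (∀ x, Φ (x, 0) = x) ∧
      (∀ x t, HasDerivAt (fun s => Φ (x, s)) (Z (Φ (x, t))) t) ∧ Continuous Φ := by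
  -- As `Z` is bounded, the Picard-Lindelöf theorem applies on any interval, on a large enough ball.
  have pl : ∀ (n : ℕ) (x₀ : V), ∃ α : V × ℝ → V, (∀ x ∈ closedBall x₀ 1, α (x, 0) = x ∧
      ∀ t ∈ Ioo (-(n + 1) : ℝ) (n + 1), HasDerivAt (fun s => α (x, s)) (Z (α (x, t))) t) ∧
      ContinuousOn α (closedBall x₀ 1 ×ˢ Ioo (-(n + 1) : ℝ) (n + 1)) := by
    intro n x₀
    have h0 : (0 : ℝ) ∈ Icc (-(n + 1) : ℝ) (n + 1) :=
      ⟨by linarith [n.cast_nonneg (α := ℝ)], by positivity⟩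
    have hpl : IsPicardLindelof (fun _ => Z) (⟨0, h0⟩ : Icc (-(n + 1) : ℝ) (n + 1)) x₀
        (C * (n + 1) + 1) 1 C K :=
      { lipschitzOnWith := fun _ _ => hZ.lipschitzOnWith
        continuousOn := fun _ _ => continuousOn_const
        norm_le := fun _ _ x _ => hC x
        mul_max_le := by simp }
    obtain ⟨α, h1, h2⟩ := hpl.exists_forall_mem_closedBall_eq_hasDerivWithinAt_continuousOn
    refine ⟨α, fun x hx => ⟨(h1 x hx).1, fun t ht => ?_⟩,
      h2.mono (prod_mono subset_rfl Ioo_subset_Icc_self)⟩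
    exact ((h1 x hx).2 t (Ioo_subset_Icc_self ht)).hasDerivAt (Icc_mem_nhds ht.1 ht.2)
  choose α hα hαc using pl
  have mem : ∀ t : ℝ, t ∈ Ioo (-((⌈|t|⌉₊ : ℕ) + 1) : ℝ) ((⌈|t|⌉₊ : ℕ) + 1) := fun t => by
    have := Nat.le_ceil |t|
    exact abs_lt.1 (by linarith)
  have mono : ∀ {m n : ℕ}, m ≤ n → Ioo (-(m + 1) : ℝ) (m + 1) ⊆ Ioo (-(n + 1) : ℝ) (n + 1) := by
    intro m n h
    have : (m : ℝ) ≤ n := by exact_mod_cast h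
    exact Ioo_subset_Ioo (by linarith) (by linarith)
  have agree' : ∀ (m n : ℕ), m ≤ n → ∀ y x : V, x ∈ closedBall y 1 → ∀ z, x ∈ closedBall z 1 →
      ∀ t ∈ Ioo (-(m + 1) : ℝ) (m + 1), α m y (x, t) = α n z (x, t) := by
    intro m n hmn y x hy z hz t ht
    have h0 : (0 : ℝ) ∈ Ioo (-(m + 1) : ℝ) (m + 1) :=
      ⟨by linarith [m.cast_nonneg (α := ℝ)], by positivity⟩
    exact ODE_solution_unique_of_mem_Ioo (v := fun _ => Z) (s := fun _ => univ)
      (fun _ _ => hZ.lipschitzOnWith) h0 (fun t ht => ⟨(hα m y x hy).2 t ht, trivial⟩)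
      (fun t ht => ⟨(hα n z x hz).2 t (mono hmn ht), trivial⟩)
      ((hα m y x hy).1.trans (hα n z x hz).1.symm) ht
  have self : ∀ x : V, x ∈ closedBall x 1 := fun x => mem_closedBall_self zero_le_one
  have agree : ∀ (n : ℕ) (y x : V), x ∈ closedBall y 1 → ∀ t ∈ Ioo (-(n + 1) : ℝ) (n + 1),
      α ⌈|t|⌉₊ x (x, t) = α n y (x, t) := by
    intro n y x hy t ht
    rcases le_total ⌈|t|⌉₊ n with h | h
    · exact agree' _ _ h x x (self x) y hy t (mem t)
    · exact (agree' _ _ h y x hy x (self x) t ht).symm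
  refine ⟨fun p => α ⌈|p.2|⌉₊ p.1 p, fun x => (hα _ x x (self x)).1, fun x t => ?_, ?_⟩
  · refine ((hα ⌈|t|⌉₊ x x (self x)).2 t (mem t)).congr_of_eventuallyEq ?_
    filter_upwards [Ioo_mem_nhds (mem t).1 (mem t).2] with s hs using agree _ x x (self x) s hs
  · refine continuous_iff_continuousAt.2 fun ⟨x, t⟩ => ?_
    have hn : closedBall x 1 ×ˢ Ioo (-((⌈|t|⌉₊ : ℕ) + 1) : ℝ) ((⌈|t|⌉₊ : ℕ) + 1) ∈ nhds (x, t) :=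
      prod_mem_nhds (closedBall_mem_nhds x one_pos) (Ioo_mem_nhds (mem t).1 (mem t).2)
    refine ((hαc ⌈|t|⌉₊ x).continuousAt hn).congr ?_
    filter_upwards [hn] with p hp using (agree _ x p.1 hp.1 p.2 hp.2).symm

/-- The radial retraction of a normed space onto its closed unit ball. -/
noncomputable def radialRetraction {V : Type*} [NormedAddCommGroup V] [NormedSpace ℝ V] (x : V) :
    V :=
  (max 1 ‖x‖)⁻¹ • x

section radialRetraction

variable {V : Type*} [NormedAddCommGroup V] [NormedSpace ℝ V]

theorem radialRetraction_mem (x : V) : radialRetraction x ∈ Metric.closedBall (0 : V) 1 := by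
  have h : 0 < max 1 ‖x‖ := lt_max_of_lt_left one_pos
  rw [mem_closedBall_zero_iff, radialRetraction, norm_smul, norm_inv, Real.norm_of_nonneg h.le,
    inv_mul_le_iff₀ h, mul_one]
  exact le_max_right _ _

theorem radialRetraction_of_norm_le_one {x : V} (hx : ‖x‖ ≤ 1) : radialRetraction x = x := by
  simp [radialRetraction, max_eq_left hx]

theorem lipschitzWith_radialRetraction : LipschitzWith 2 (radialRetraction : V → V) := by
  refine LipschitzWith.of_dist_le_mul fun x y => ?_
  have ha : 1 ≤ max 1 ‖x‖ := le_max_left _ _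
  have hb : 1 ≤ max 1 ‖y‖ := le_max_left _ _
  have hy : ‖y‖ ≤ max 1 ‖y‖ := le_max_right _ _
  have hab : |max 1 ‖y‖ - max 1 ‖x‖| ≤ ‖x - y‖ := by
    rw [max_comm 1, max_comm 1, norm_sub_rev x]
    exact (abs_max_sub_max_le_abs _ _ _).trans (abs_norm_sub_norm_le y x)
  simp only [radialRetraction, dist_eq_norm]
  generalize max 1 ‖x‖ = a at *
  generalize max 1 ‖y‖ = b at *
  have ha0 : 0 < a := by linarith
  have hb0 : 0 < b := by linarith
  have key : a⁻¹ • x - b⁻¹ • y = a⁻¹ • (x - y) + ((b - a) * a⁻¹ * b⁻¹) • y := by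
    have : (b - a) * a⁻¹ * b⁻¹ = a⁻¹ - b⁻¹ := by field_simp
    rw [this]; module
  rw [key]
  refine (norm_add_le _ _).trans ?_
  have h1 : ‖a⁻¹ • (x - y)‖ ≤ ‖x - y‖ := by
    rw [norm_smul, norm_inv, Real.norm_of_nonneg ha0.le, inv_mul_le_iff₀ ha0]
    nlinarith [norm_nonneg (x - y)]
  have h2 : ‖((b - a) * a⁻¹ * b⁻¹) • y‖ ≤ ‖x - y‖ := by
    have e : ‖((b - a) * a⁻¹ * b⁻¹) • y‖ = |b - a| * (a⁻¹ * (b⁻¹ * ‖y‖)) := by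
      rw [norm_smul, norm_mul, norm_mul, norm_inv, norm_inv, Real.norm_of_nonneg ha0.le,
        Real.norm_of_nonneg hb0.le, Real.norm_eq_abs]
      ring
    have h3 : b⁻¹ * ‖y‖ ≤ 1 := by rwa [inv_mul_le_iff₀ hb0, mul_one]
    have h4 : a⁻¹ * (b⁻¹ * ‖y‖) ≤ 1 := mul_le_one₀ (inv_le_one_of_one_le₀ ha) (by positivity) h3
    rw [e]
    exact (mul_le_of_le_one_right (abs_nonneg _) h4).trans hab
  push_cast
  linarith

end radialRetraction

namespace LF

variable {E : Type*} [NormedAddCommGroup E]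

/-! ### The equations on the sphere -/

theorem UnitSphere.sq_norm_le (v : UnitSphere E) : ‖v.1.1‖ ^ 2 ≤ 1 := by
  nlinarith [v.2, sq_nonneg v.1.2]

theorem UnitSphere.norm_fst_le (v : UnitSphere E) : ‖v.1.1‖ ≤ 1 := by
  nlinarith [v.sq_norm_le, norm_nonneg v.1.1]

theorem UnitSphere.abs_snd_le (v : UnitSphere E) : |v.1.2| ≤ 1 := by
  rw [abs_le_one_iff_mul_self_le_one]
  nlinarith [v.2, sq_nonneg ‖v.1.1‖]

theorem UnitSphere.norm_le (v : UnitSphere E) : ‖(v : E × ℝ)‖ ≤ 1 :=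
  max_le v.norm_fst_le v.abs_snd_le

theorem UnitSphere.fst_mem (v : UnitSphere E) : v.1.1 ∈ Metric.closedBall (0 : E) 1 := by
  simpa using v.norm_fst_le

variable [InnerProductSpace ℝ E]

/-- The vector field `(ξ, η) ↦ (η F(ξ), -⟨F(ξ), ξ⟩)` on `E × ℝ`, which is tangent to the unit
sphere. -/
noncomputable def sphereField (F : E → E) (v : E × ℝ) : E × ℝ :=
  (v.2 • F v.1, -inner ℝ (F v.1) v.1)

theorem contDiffOn_sphereField {F : E → E} (hF : ContDiffOn ℝ ∞ F (Metric.closedBall 0 1)) :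
    ContDiffOn ℝ ∞ (sphereField F) (Metric.closedBall 0 1) := by
  have h : ContDiffOn ℝ ∞ (fun v : E × ℝ => F v.1) (Metric.closedBall 0 1) := by
    refine hF.comp contDiff_fst.contDiffOn fun v hv => ?_
    simp only [mem_closedBall_zero_iff] at hv ⊢
    exact (norm_fst_le v).trans hv
  exact (contDiff_snd.contDiffOn.smul h).prodMk (h.inner ℝ contDiff_fst.contDiffOn).neg

variable [FiniteDimensional ℝ E]

theorem exists_lipschitzOnWith_sphereField {F : E → E}
    (hF : ContDiffOn ℝ ∞ F (Metric.closedBall 0 1)) :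
    ∃ K, LipschitzOnWith K (sphereField F) (Metric.closedBall 0 1) :=
  (contDiffOn_sphereField hF).exists_lipschitzOnWith (by simp) (convex_closedBall _ _)
    (isCompact_closedBall _ _)

/-- The flow on the unit sphere. The field is composed with the radial retraction onto the unit
ball of `E × ℝ`; the result is bounded and Lipschitz, and still orthogonal to the position, so that
`‖ξ‖² + η²` is a constant of motion. -/
theorem exists_sphereFlow {F : E → E} (hF : ContDiffOn ℝ ∞ F (Metric.closedBall 0 1)) :
    ∃ Φ : UnitSphere E × ℝ → UnitSphere E, (∀ v, Φ (v, 0) = v) ∧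
      (∀ v t, HasDerivAt (fun s => (Φ (v, s) : E × ℝ)) (sphereField F (Φ (v, t))) t) ∧
      Continuous Φ := by
  obtain ⟨K, hK⟩ := exists_lipschitzOnWith_sphereField hF
  have hlip : LipschitzWith (K * 2) (sphereField F ∘ radialRetraction) := by
    rw [← lipschitzOnWith_univ]
    exact hK.comp lipschitzWith_radialRetraction.lipschitzOnWith fun x _ => radialRetraction_mem x
  obtain ⟨C, hC⟩ := (isCompact_closedBall (0 : E × ℝ) 1).exists_bound_of_continuousOn
    hK.continuousOn
  obtain ⟨Φ, h0, hd, hc⟩ := hlip.exists_global_flow (C := ⟨max C 0, le_max_right _ _⟩)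
    fun x => (hC _ (radialRetraction_mem x)).trans (le_max_left _ _)
  have hN : ∀ (v : UnitSphere E) (t : ℝ), ‖(Φ (v, t)).1‖ ^ 2 + (Φ (v, t)).2 ^ 2 = 1 := by
    intro v t
    have hder : ∀ s, HasDerivAt (fun s => ‖(Φ ((v : E × ℝ), s)).1‖ ^ 2 + (Φ (v, s)).2 ^ 2) 0 s := by
      intro s
      have h1 := ((hasFDerivAt_fst (𝕜 := ℝ) (p := Φ (v, s))).comp_hasDerivAt s (hd v s)).norm_sq
      have h2 := ((hasFDerivAt_snd (𝕜 := ℝ) (p := Φ (v, s))).comp_hasDerivAt s (hd v s)).pow 2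
      refine (h1.add h2).congr_deriv ?_
      simp only [Function.comp_apply, sphereField, radialRetraction, ContinuousLinearMap.coe_fst',
        ContinuousLinearMap.coe_snd', Prod.smul_fst, Prod.smul_snd, inner_smul_right, smul_eq_mul]
      rw [real_inner_comm]
      push_cast
      ring
    have := is_const_of_deriv_eq_zero (fun s => (hder s).differentiableAt)
      (fun s => (hder s).deriv) t 0
    simp only [h0] at this
    rw [this, v.2]
  refine ⟨fun p => ⟨Φ (p.1, p.2), hN p.1 p.2⟩, fun v => Subtype.ext (h0 v), fun v t => ?_, ?_⟩
  · have := hd v t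
    rwa [Function.comp_apply, radialRetraction_of_norm_le_one
      (UnitSphere.norm_le ⟨Φ (v, t), hN v t⟩)] at this
  · exact (hc.comp ((continuous_subtype_val.comp continuous_fst).prodMk continuous_snd)).subtype_mk _

end LF

/-! ### Periodic curves -/

/-- A continuous non-constant curve which follows the same path after each visit to a point, and
which is periodic, is injective modulo its minimal period. -/
theorem exists_minimal_period {X : Type*} [TopologicalSpace X] [T2Space X] {g : ℝ → X}
    (hg : Continuous g) (hflow : ∀ s t, g s = g t → ∀ r, g (s + r) = g (t + r))
    {P : ℝ} (hP : P ≠ 0) (hper : g P = g 0) (hconst : ∃ s t, g s ≠ g t) :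
    ∃ T : ℝ, 0 < T ∧ ∀ s t, g s = g t ↔ ∃ k : ℤ, t = s + k * T := by
  let H : AddSubgroup ℝ :=
    { carrier := {r | ∀ s, g (s + r) = g s}
      zero_mem' := by simp
      add_mem' := by
        intro a b ha hb s
        rw [← add_assoc, hb, ha]
      neg_mem' := by
        intro a ha s
        have := ha (s + -a)
        simpa using this.symm }
  have mem_H : ∀ {s t}, g s = g t → t - s ∈ H := by
    intro s t h r
    have := hflow s t h (r - s)
    rw [add_sub_cancel] at this
    rw [this]
    ring_nf
  have hclosed : IsClosed (H : Set ℝ) := by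
    have : (H : Set ℝ) = ⋂ s, {r | g (s + r) = g s} := by ext; simp [H]
    rw [this]
    exact isClosed_iInter fun s => isClosed_eq (by fun_prop) continuous_const
  rcases H.dense_or_cyclic with hd | ⟨a, ha⟩
  · obtain ⟨s, t, hst⟩ := hconst
    have : t - s ∈ (H : Set ℝ) := by
      rw [hclosed.closure_eq.symm, hd.closure_eq]; trivial
    exact absurd (by simpa using (this s).symm) hst
  · rw [← AddSubgroup.zmultiples_eq_closure] at ha
    have hPH : P ∈ H := by simpa using mem_H hper.symm
    have ha0 : a ≠ 0 := by
      rintro rfl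
      rw [ha] at hPH
      obtain ⟨k, hk⟩ := AddSubgroup.mem_zmultiples_iff.1 hPH
      exact hP (by simpa using hk.symm)
    have hH : ∀ r, r ∈ H ↔ ∃ k : ℤ, r = k * |a| := by
      intro r
      rw [ha, AddSubgroup.mem_zmultiples_iff]
      rcases abs_choice a with h | h <;> rw [h]
      · simp [eq_comm]
      · exact ⟨fun ⟨k, hk⟩ => ⟨-k, by simp [← hk]⟩, fun ⟨k, hk⟩ => ⟨-k, by simp [hk]⟩⟩
    refine ⟨|a|, abs_pos.2 ha0, fun s t => ⟨fun h => ?_, fun ⟨k, hk⟩ => ?_⟩⟩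
    · obtain ⟨k, hk⟩ := (hH _).1 (mem_H h)
      exact ⟨k, by linarith⟩
    · have := (hH (k * |a|)).2 ⟨k, rfl⟩ s
      rw [hk, this]

namespace LF

/-! ### Solutions: uniqueness, existence and symmetries -/

variable {E : Type*} [NormedAddCommGroup E] [InnerProductSpace ℝ E]

/-- The reflection `(ξ, η) ↦ (ξ, -η)` of the sphere. -/
def UnitSphere.flip (v : UnitSphere E) : UnitSphere E := ⟨(v.1.1, -v.1.2), by simpa using v.2⟩

omit [InnerProductSpace ℝ E] in
theorem UnitSphere.flip_eq_self {v : UnitSphere E} (h : v.1.2 = 0) : v.flip = v :=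
  Subtype.ext (Prod.ext rfl (by simp [flip, h]))

namespace IsSolution

variable {L : E →L[ℝ] E} {F : E → E} {c c' : ℝ → SG E}

theorem hasDerivAt_sphere (h : IsSolution L F c) (t : ℝ) :
    HasDerivAt (fun s => ((c s).2.2 : E × ℝ)) (sphereField F (c t).2.2) t :=
  (h.deriv_xi t).prodMk (h.deriv_eta t)

theorem continuous_snd (h : IsSolution L F c) : Continuous fun t => (c t).2 :=
  (continuous_iff_continuousAt.2 fun t => (h.deriv_u t).continuousAt).prodMk
    ((continuous_iff_continuousAt.2 fun t => (h.hasDerivAt_sphere t).continuousAt).subtype_mk _)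

theorem continuous_eta (h : IsSolution L F c) : Continuous fun t => (c t).2.2.1.2 :=
  continuous_iff_continuousAt.2 fun t => (h.deriv_eta t).continuousAt

theorem comp_add (h : IsSolution L F c) (a : ℝ) : IsSolution L F fun t => c (t + a) where
  deriv_xi t := (h.deriv_xi (t + a)).comp_add_const t a
  deriv_eta t := (h.deriv_eta (t + a)).comp_add_const t a
  deriv_w t := (h.deriv_w (t + a)).comp_add_const t a
  deriv_u t := (h.deriv_u (t + a)).comp_add_const t a

theorem const_add (h : IsSolution L F c) (w : E) :
    IsSolution L F fun t => (w + (c t).1, (c t).2) where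
  deriv_xi := h.deriv_xi
  deriv_eta := h.deriv_eta
  deriv_w t := (h.deriv_w t).const_add w
  deriv_u := h.deriv_u

/-- The system is reversible: `(w, u; ξ, η) ↦ (-w, u; ξ, -η)` reverses the direction of time. -/
theorem reflect (h : IsSolution L F c) (a : ℝ) :
    IsSolution L F fun t => (-(c (a - t)).1, (c (a - t)).2.1, (c (a - t)).2.2.flip) where
  deriv_xi t := by simpa [UnitSphere.flip] using (h.deriv_xi (a - t)).comp_const_sub a t
  deriv_eta t := by
    simpa [UnitSphere.flip] using ((h.deriv_eta (a - t)).comp_const_sub a t).fun_neg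
  deriv_w t := by simpa [UnitSphere.flip] using ((h.deriv_w (a - t)).comp_const_sub a t).fun_neg
  deriv_u t := by simpa [UnitSphere.flip] using (h.deriv_u (a - t)).comp_const_sub a t

/-- Reversal of time turns solutions for `(L, F)` into solutions for `(-L, -F)`. -/
theorem reverse (h : IsSolution L F c) :
    IsSolution (-L) (fun x => -F x) fun t => (-(c (-t)).1, -(c (-t)).2.1, (c (-t)).2.2) where
  deriv_xi t := by simpa using (h.deriv_xi (0 - t)).comp_const_sub 0 t
  deriv_eta t := by simpa using (h.deriv_eta (0 - t)).comp_const_sub 0 t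
  deriv_w t := by simpa using ((h.deriv_w (0 - t)).comp_const_sub 0 t).fun_neg
  deriv_u t := by simpa using ((h.deriv_u (0 - t)).comp_const_sub 0 t).fun_neg

variable [FiniteDimensional ℝ E]

theorem sphere_unique (hF : ContDiffOn ℝ ∞ F (Metric.closedBall 0 1)) (h : IsSolution L F c)
    (h' : IsSolution L F c') {t₀ : ℝ} (h₀ : (c t₀).2.2 = (c' t₀).2.2) (t : ℝ) :
    (c t).2.2 = (c' t).2.2 := by
  obtain ⟨K, hK⟩ := exists_lipschitzOnWith_sphereField hF
  refine Subtype.ext (congrFun (ODE_solution_unique_univ (v := fun _ => sphereField F)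
    (s := fun _ => Metric.closedBall 0 1) (t₀ := t₀) (fun _ => hK)
    (fun t => ⟨h.hasDerivAt_sphere t, ?_⟩) (fun t => ⟨h'.hasDerivAt_sphere t, ?_⟩)
    (congrArg Subtype.val h₀)) t)
  all_goals simpa using UnitSphere.norm_le _

theorem snd_unique (hF : ContDiffOn ℝ ∞ F (Metric.closedBall 0 1)) (h : IsSolution L F c)
    (h' : IsSolution L F c') {t₀ : ℝ} (h₀ : (c t₀).2 = (c' t₀).2) (t : ℝ) :
    (c t).2 = (c' t).2 := by
  have hs := h.sphere_unique hF h' (congrArg Prod.snd h₀)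
  have hd : ∀ t, HasDerivAt (fun t => (c t).2.1 - (c' t).2.1) 0 t := fun t =>
    ((h.deriv_u t).sub (h'.deriv_u t)).congr_deriv (by rw [hs t, sub_self])
  have := is_const_of_deriv_eq_zero (fun t => (hd t).differentiableAt) (fun t => (hd t).deriv) t t₀
  simp only [h₀, sub_self, sub_eq_zero] at this
  exact Prod.ext this (hs t)

omit [FiniteDimensional ℝ E] in
theorem fst_sub_eq (h : IsSolution L F c) (h' : IsSolution L F c')
    (h₀ : ∀ t, (c t).2 = (c' t).2) (s t : ℝ) :
    (c t).1 - (c' t).1 = (c s).1 - (c' s).1 := by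
  have hd : ∀ t, HasDerivAt (fun t => (c t).1 - (c' t).1) 0 t := fun t =>
    ((h.deriv_w t).sub (h'.deriv_w t)).congr_deriv (by rw [h₀ t, sub_self])
  exact is_const_of_deriv_eq_zero (fun t => (hd t).differentiableAt) (fun t => (hd t).deriv) t s

theorem unique (hF : ContDiffOn ℝ ∞ F (Metric.closedBall 0 1)) (h : IsSolution L F c)
    (h' : IsSolution L F c') {t₀ : ℝ} (h₀ : c t₀ = c' t₀) (t : ℝ) : c t = c' t := by
  have hs := h.snd_unique hF h' (congrArg Prod.snd h₀)
  have := h.fst_sub_eq h' hs t₀ t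
  rw [h₀, sub_self, sub_eq_zero] at this
  exact Prod.ext this (hs t)

/-- After a visit to the same base point `(u; ξ, η)`, a solution runs through the same base
points. -/
theorem snd_add_eq (hF : ContDiffOn ℝ ∞ F (Metric.closedBall 0 1)) (h : IsSolution L F c)
    (h' : IsSolution L F c') {s t : ℝ} (hst : (c s).2 = (c' t).2) (r : ℝ) :
    (c (s + r)).2 = (c' (t + r)).2 := by
  have := (h.comp_add s).snd_unique hF (h'.comp_add t) (t₀ := 0) (by simpa using hst) r
  simpa [add_comm] using this

/-- Along a solution, `(u, ξ)` is even and `η` is odd about each zero of `η`. -/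
theorem snd_reflect (hF : ContDiffOn ℝ ∞ F (Metric.closedBall 0 1)) (h : IsSolution L F c)
    {z : ℝ} (hz : (c z).2.2.1.2 = 0) (t : ℝ) :
    (c t).2 = ((c (2 * z - t)).2.1, (c (2 * z - t)).2.2.flip) := by
  refine h.snd_unique hF (h.reflect (2 * z)) (t₀ := z) ?_ t
  have : 2 * z - z = z := by ring
  simp only [this, UnitSphere.flip_eq_self hz]

/-- The composition of two reflections is a translation: two distinct zeros of `η` force
`(u; ξ, η)` to be periodic. -/
theorem snd_periodic (hF : ContDiffOn ℝ ∞ F (Metric.closedBall 0 1)) (h : IsSolution L F c)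
    {z z' : ℝ} (hz : (c z).2.2.1.2 = 0) (hz' : (c z').2.2.1.2 = 0) :
    (c (2 * (z' - z))).2 = (c 0).2 := by
  rw [h.snd_reflect hF hz 0, h.snd_reflect hF hz']
  ring_nf

end IsSolution

theorem contDiff_exp_clm [CompleteSpace E] :
    ContDiff ℝ ∞ (NormedSpace.exp : (E →L[ℝ] E) → (E →L[ℝ] E)) :=
  contDiff_iff_contDiffAt.2 fun x => (NormedSpace.exp_analytic (𝕂 := ℝ) x).contDiffAt

/-- All solutions at once: they exist, they depend continuously on the initial values, and they
are equivariant under the translations of `w`. -/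
theorem exists_solutions [FiniteDimensional ℝ E] (L : E →L[ℝ] E) {F : E → E}
    (hF : ContDiffOn ℝ ∞ F (Metric.closedBall 0 1)) :
    ∃ (W : (ℝ × UnitSphere E) × ℝ → E) (R : (ℝ × UnitSphere E) × ℝ → ℝ × UnitSphere E),
      Continuous W ∧ Continuous R ∧ (∀ q, W (q, 0) = 0) ∧ (∀ q, R (q, 0) = q) ∧
      ∀ p : SG E, IsSolution L F fun t => (p.1 + W (p.2, t), R (p.2, t)) := by
  have := FiniteDimensional.complete ℝ E
  obtain ⟨Φ, h0, hd, hc⟩ := exists_sphereFlow hF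
  have hη : Continuous (Function.uncurry fun (v : UnitSphere E) s => (Φ (v, s)).1.2) :=
    continuous_snd.comp (continuous_subtype_val.comp hc)
  have hU : Continuous fun p : UnitSphere E × ℝ => ∫ s in (0 : ℝ)..p.2, (Φ (p.1, s)).1.2 :=
    intervalIntegral.continuous_parametric_primitive_of_continuous hη
  set U : UnitSphere E × ℝ → ℝ := fun p => ∫ s in (0 : ℝ)..p.2, (Φ (p.1, s)).1.2
  have hexp : Continuous (NormedSpace.exp : (E →L[ℝ] E) → (E →L[ℝ] E)) :=
    contDiff_exp_clm.continuous
  have hw : Continuous (Function.uncurry fun (q : ℝ × UnitSphere E) s =>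
      NormedSpace.exp ((q.1 + U (q.2, s)) • L) (Φ (q.2, s)).1.1) := by
    refine (hexp.comp ?_).clm_apply ?_ <;> fun_prop
  refine ⟨fun p => ∫ s in (0 : ℝ)..p.2, NormedSpace.exp ((p.1.1 + U (p.1.2, s)) • L)
    (Φ (p.1.2, s)).1.1, fun p => (p.1.1 + U (p.1.2, p.2), Φ (p.1.2, p.2)),
    intervalIntegral.continuous_parametric_primitive_of_continuous hw, by fun_prop, by simp,
    fun q => by simp [U, h0], fun p => ⟨fun t => ?_, fun t => ?_, fun t => ?_, fun t => ?_⟩⟩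
  · exact (hasFDerivAt_fst (𝕜 := ℝ)).comp_hasDerivAt t (hd p.2.2 t)
  · exact (hasFDerivAt_snd (𝕜 := ℝ)).comp_hasDerivAt t (hd p.2.2 t)
  · have := hw.comp (Continuous.prodMk_right p.2)
    exact (intervalIntegral.integral_hasDerivAt_right (this.intervalIntegrable _ _)
      (this.stronglyMeasurableAtFilter _ _) this.continuousAt).const_add _
  · have := hη.comp (Continuous.prodMk_right p.2.2)
    have hUd : HasDerivAt (fun t => U (p.2.2, t)) (Φ (p.2.2, t)).1.2 t :=
      intervalIntegral.integral_hasDerivAt_right (this.intervalIntegrable 0 t)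
        (this.stronglyMeasurableAtFilter _ _) this.continuousAt
    exact hUd.const_add p.2.1

/-! ### Oscillating solutions -/

/-- The coordinate `η` changes its sign at least twice along the curve. -/
def Oscillates (c : ℝ → SG E) : Prop :=
  ∃ t₁ t₂ t₃, t₁ < t₂ ∧ t₂ < t₃ ∧
    (c t₁).2.2.1.2 * (c t₂).2.2.1.2 < 0 ∧ (c t₂).2.2.1.2 * (c t₃).2.2.1.2 < 0

omit [InnerProductSpace ℝ E] in
theorem Oscillates.comp_add {c : ℝ → SG E} (h : Oscillates c) (a : ℝ) :
    Oscillates fun t => c (t + a) := by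
  obtain ⟨t₁, t₂, t₃, h12, h23, h1, h2⟩ := h
  exact ⟨t₁ - a, t₂ - a, t₃ - a, by linarith, by linarith, by simpa using h1, by simpa using h2⟩

theorem exists_mem_Ioo_eq_zero {f : ℝ → ℝ} (hf : Continuous f) {a b : ℝ} (hab : a < b)
    (h : f a * f b < 0) : ∃ z ∈ Set.Ioo a b, f z = 0 := by
  rcases mul_neg_iff.1 h with ⟨ha, hb⟩ | ⟨ha, hb⟩
  · obtain ⟨z, hz, h0⟩ := intermediate_value_Ioo' hab.le hf.continuousOn ⟨hb, ha⟩
    exact ⟨z, hz, h0⟩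
  · obtain ⟨z, hz, h0⟩ := intermediate_value_Ioo hab.le hf.continuousOn ⟨ha, hb⟩
    exact ⟨z, hz, h0⟩

/-- The base points `(u; ξ, η)` of an oscillating solution run through a simple closed curve. -/
theorem Oscillates.exists_period [FiniteDimensional ℝ E] {L : E →L[ℝ] E} {F : E → E}
    {c : ℝ → SG E} (ho : Oscillates c) (hF : ContDiffOn ℝ ∞ F (Metric.closedBall 0 1))
    (h : IsSolution L F c) :
    ∃ T : ℝ, 0 < T ∧ ∀ s t, (c s).2 = (c t).2 ↔ ∃ k : ℤ, t = s + k * T := by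
  obtain ⟨t₁, t₂, t₃, h12, h23, h1, h2⟩ := ho
  obtain ⟨z, hz, hz0⟩ := exists_mem_Ioo_eq_zero h.continuous_eta h12 h1
  obtain ⟨z', hz', hz0'⟩ := exists_mem_Ioo_eq_zero h.continuous_eta h23 h2
  have hlt : z < z' := hz.2.trans hz'.1
  refine exists_minimal_period h.continuous_snd (fun s t hst => h.snd_add_eq hF h hst)
    (by linarith : 0 < 2 * (z' - z)).ne' (h.snd_periodic hF hz0 hz0') ⟨t₁, t₂, fun heq => ?_⟩
  rw [heq] at h1
  nlinarith [mul_self_nonneg (c t₂).2.2.1.2]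

end LF

namespace LF

/-! ### Escaping points -/

open Set Filter Topology

theorem tendsto_atTop_of_tendsto_deriv {f f' : ℝ → ℝ} (hf : ∀ t, HasDerivAt f (f' t) t) {l : ℝ}
    (hl : 0 < l) (hf' : Tendsto f' atTop (𝓝 l)) : Tendsto f atTop atTop := by
  obtain ⟨N, hN⟩ := eventually_atTop.1 (hf'.eventually_const_le (half_lt_self hl))
  have key : ∀ t ≥ N, f N + l / 2 * (t - N) ≤ f t := by
    intro t ht
    have := (convex_Ici N).mul_sub_le_image_sub_of_le_deriv (f := f) (C := l / 2)
      (fun t _ => (hf t).continuousAt.continuousWithinAt)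
      (fun t _ => (hf t).differentiableAt.differentiableWithinAt)
      (fun t ht => by
        rw [(hf t).deriv]
        exact hN t (interior_subset ht)) N self_mem_Ici t ht ht
    linarith
  refine tendsto_atTop_mono' _ (eventually_atTop.2 ⟨N, key⟩) ?_
  refine tendsto_atTop_add_const_left _ _ (Tendsto.const_mul_atTop (by positivity) ?_)
  exact tendsto_atTop_add_const_right _ _ tendsto_id

variable {E : Type*} [NormedAddCommGroup E] [InnerProductSpace ℝ E]

theorem IsEscaping.neg {F : E → E} {x : E} (h : IsEscaping F x) :
    IsEscaping (fun x => -F x) x := by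
  obtain ⟨hx, a, b, ζ, h0, hζ0, hζ, hball, ha, hb, hFa, hFb⟩ := h
  refine ⟨hx, -b, -a, fun s => ζ (-s), ⟨by linarith [h0.2], by linarith [h0.1]⟩, by simpa,
    fun s hs => ?_, fun s hs => hball _ ⟨by linarith [hs.2], by linarith [hs.1]⟩, by simpa using hb,
    by simpa using ha, by simpa using hFb, by simpa using hFa⟩
  have := (hζ (-s) ⟨by linarith [hs.2], by linarith [hs.1]⟩).scomp s
    (hasDerivAt_neg s).hasDerivWithinAt (s := Icc (-b) (-a))
    fun s hs => ⟨by linarith [hs.2], by linarith [hs.1]⟩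
  simpa [Function.comp_def] using this

variable [FiniteDimensional ℝ E] {L : E →L[ℝ] E} {F : E → E} {c : ℝ → SG E}

/-- As long as `η ≥ 0`, `ξ(t) = ζ(u(t) - u(0))` moves along the integral curve `ζ` of `F` through the
escaping point `ξ(0)`. If `η` never became negative, then `u(t) - u(0)` would reach, or converge
to, the parameter value at which `ζ` leaves the ball (by `η² = 1 - ‖ζ‖²`), where the derivative of
`η` is negative. -/
theorem IsSolution.exists_eta_neg (hF : ContDiffOn ℝ ∞ F (Metric.closedBall 0 1))
    (h : IsSolution L F c) (he : IsEscaping F (c 0).2.2.1.1) :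
    ∃ t > 0, (c t).2.2.1.2 < 0 := by
  obtain ⟨hx, a, b, ζ, h0, hζ0, hζ, hball, ha, hb, -, hFb⟩ := he
  by_contra! hη
  obtain ⟨K, hK⟩ := hF.exists_lipschitzOnWith (by simp) (convex_closedBall _ _)
    (isCompact_closedBall _ _)
  have ha0 : a < 0 := by
    refine h0.1.lt_of_ne ?_
    rintro rfl
    rw [hζ0, mem_sphere_zero_iff_norm] at ha
    simp [ha] at hx
  have hb0 : 0 < b := by
    refine h0.2.lt_of_ne ?_
    rintro rfl
    rw [hζ0, mem_sphere_zero_iff_norm] at hb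
    simp [hb] at hx
  have hζmem : ∀ s ∈ Icc a b, ζ s ∈ Metric.closedBall (0 : E) 1 := by
    intro s hs
    rcases hs.1.eq_or_lt with rfl | h1
    · exact Metric.sphere_subset_closedBall ha
    rcases hs.2.eq_or_lt with rfl | h2
    · exact Metric.sphere_subset_closedBall hb
    exact Metric.ball_subset_closedBall (hball s ⟨h1, h2⟩)
  set U : ℝ → ℝ := fun t => (c t).2.1 - (c 0).2.1
  have hU0 : U 0 = 0 := sub_self _
  have hUd : ∀ t, HasDerivAt U (c t).2.2.1.2 t := fun t => (h.deriv_u t).sub_const _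
  have hUc : Continuous U := continuous_iff_continuousAt.2 fun t => (hUd t).continuousAt
  have hUm : MonotoneOn U (Ici 0) := by
    refine monotoneOn_of_deriv_nonneg (convex_Ici 0) hUc.continuousOn
      (fun t _ => (hUd t).differentiableAt.differentiableWithinAt) fun t ht => ?_
    rw [interior_Ici] at ht
    rw [(hUd t).deriv]
    exact hη t ht
  have hUpos : ∀ t ≥ 0, 0 ≤ U t := fun t ht => hU0.symm.trans_le (hUm self_mem_Ici ht ht)
  have follow : ∀ T ≥ 0, U T ≤ b → (c T).2.2.1.1 = ζ (U T) := by
    intro T hT hUT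
    have hUmem : MapsTo U (Icc 0 T) (Icc a b) := fun t ht =>
      ⟨ha0.le.trans (hUpos t ht.1), (hUm ht.1 hT ht.2).trans hUT⟩
    have hd : ∀ t ∈ Icc 0 T, HasDerivWithinAt (fun s => ζ (U s))
        ((c t).2.2.1.2 • F (ζ (U t))) (Icc 0 T) t := fun t ht =>
      (hζ (U t) (hUmem ht)).scomp t (hUd t).hasDerivWithinAt hUmem
    refine ODE_solution_unique_of_mem_Icc_right (K := K) (a := 0) (b := T)
      (v := fun t x => (c t).2.2.1.2 • F x) (s := fun _ => Metric.closedBall 0 1)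
      (fun t _ => ?_) (fun t _ => (h.deriv_xi t).continuousAt.continuousWithinAt)
      (fun t _ => (h.deriv_xi t).hasDerivWithinAt) (fun t _ => UnitSphere.fst_mem _)
      (fun t ht => (hd t ht).continuousWithinAt)
      (fun t ht => (hd t (Ico_subset_Icc_self ht)).mono_of_mem_nhdsWithin ?_)
      (fun t ht => hζmem _ (hUmem (Ico_subset_Icc_self ht))) ?_ ⟨hT, le_rfl⟩
    · refine LipschitzOnWith.of_dist_le_mul fun x hx y hy => ?_
      rw [dist_smul₀]
      refine (mul_le_of_le_one_left dist_nonneg ?_).trans (hK.dist_le_mul x hx y hy)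
      exact UnitSphere.abs_snd_le _
    · exact mem_of_superset (Icc_mem_nhdsGE ht.2) (Icc_subset_Icc_left ht.1)
    · simp [hU0, hζ0]
  by_cases hcase : ∃ t ≥ 0, b ≤ U t
  · -- `u` reaches the value for which `ζ` leaves the ball: `η` has a minimum there, but `η' < 0`
    obtain ⟨t, ht, hbt⟩ := hcase
    obtain ⟨t₁, ht₁, hUt₁⟩ := intermediate_value_Icc ht hUc.continuousOn
      (⟨hU0.trans_le hb0.le, hbt⟩ : b ∈ Icc (U 0) (U t))
    have ht₁0 : 0 < t₁ := ht₁.1.lt_of_ne (by rintro rfl; linarith)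
    have hξ : (c t₁).2.2.1.1 = ζ b := by rw [follow t₁ ht₁.1 hUt₁.le, hUt₁]
    have hηt₁ : (c t₁).2.2.1.2 = 0 := by
      have := (c t₁).2.2.2
      rw [hξ, mem_sphere_zero_iff_norm.1 hb] at this
      simpa using this
    have hmin : IsLocalMin (fun s => (c s).2.2.1.2) t₁ := by
      filter_upwards [Ioi_mem_nhds ht₁0] with s hs
      rw [hηt₁]
      exact hη s hs
    have := hmin.hasDerivAt_eq_zero (h.deriv_eta t₁)
    rw [hξ] at this
    linarith
  · push Not at hcase
    have hVm : Monotone fun t => U (max t 0) := fun s t hst =>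
      hUm (mem_Ici.2 (le_max_right _ _)) (mem_Ici.2 (le_max_right _ _)) (max_le_max_right 0 hst)
    have hVb : BddAbove (range fun t => U (max t 0)) :=
      ⟨b, by rintro _ ⟨t, rfl⟩; exact (hcase _ (le_max_right _ _)).le⟩
    set l := ⨆ t, U (max t 0)
    have hlim : Tendsto U atTop (𝓝 l) := by
      refine (tendsto_atTop_ciSup hVm hVb).congr' ?_
      filter_upwards [eventually_ge_atTop 0] with t ht
      rw [max_eq_left ht]
    have hlb : l ≤ b := le_of_tendsto hlim (by
      filter_upwards [eventually_ge_atTop 0] with t ht using (hcase t ht).le)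
    have hl0 : 0 ≤ l := ge_of_tendsto hlim (by
      filter_upwards [eventually_ge_atTop 0] with t ht using hUpos t ht)
    have hlmem : l ∈ Icc a b := ⟨by linarith, hlb⟩
    have hξlim : Tendsto (fun t => (c t).2.2.1.1) atTop (𝓝 (ζ l)) := by
      have h1 : Tendsto U atTop (𝓝[Icc a b] l) := by
        refine tendsto_nhdsWithin_iff.2 ⟨hlim, ?_⟩
        filter_upwards [eventually_ge_atTop 0] with t ht
        exact ⟨by linarith [hUpos t ht], (hcase t ht).le⟩
      refine ((hζ l hlmem).continuousWithinAt.tendsto.comp h1).congr' ?_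
      filter_upwards [eventually_ge_atTop 0] with t ht
      exact (follow t ht (hcase t ht).le).symm
    have hηlim : Tendsto (fun t => (c t).2.2.1.2) atTop (𝓝 √(1 - ‖ζ l‖ ^ 2)) := by
      refine ((hξlim.norm.pow 2).const_sub 1).sqrt.congr' ?_
      filter_upwards [eventually_gt_atTop 0] with t ht
      have : 1 - ‖(c t).2.2.1.1‖ ^ 2 = (c t).2.2.1.2 ^ 2 := by linarith [(c t).2.2.2]
      rw [this, Real.sqrt_sq (hη t ht)]
    have hζl : ‖ζ l‖ ≤ 1 := by simpa using hζmem l hlmem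
    rcases hζl.lt_or_eq with hlt | heq
    · -- `u' = η` has a positive limit although `u` is bounded
      have hpos : 0 < √(1 - ‖ζ l‖ ^ 2) := Real.sqrt_pos.2 (by nlinarith [norm_nonneg (ζ l)])
      obtain ⟨t, ht, hbt⟩ := ((eventually_ge_atTop 0).and
        ((tendsto_atTop_of_tendsto_deriv hUd hpos hηlim).eventually_ge_atTop b)).exists
      exact absurd (hcase t ht) (not_lt.2 hbt)
    · -- `u` converges to the value for which `ζ` leaves the ball, and `η'` has a negative limit
      have hlb' : l = b := by
        by_contra hne
        have := hball l ⟨by linarith, lt_of_le_of_ne hlb hne⟩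
        rw [mem_ball_zero_iff] at this
        linarith
      have hFlim : Tendsto (fun t => F (c t).2.2.1.1) atTop (𝓝 (F (ζ l))) := by
        refine (hF.continuousOn (ζ l) (hζmem l hlmem)).tendsto.comp ?_
        exact tendsto_nhdsWithin_iff.2 ⟨hξlim, Eventually.of_forall fun t => UnitSphere.fst_mem _⟩
      have hpos : 0 < inner ℝ (F (ζ l)) (ζ l) := by rwa [hlb']
      have hd : ∀ t, HasDerivAt (fun t => -(c t).2.2.1.2)
          (inner ℝ (F (c t).2.2.1.1) (c t).2.2.1.1) t := fun t => by
        simpa using (h.deriv_eta t).fun_neg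
      obtain ⟨t, ht, hbt⟩ := ((eventually_gt_atTop 0).and ((tendsto_atTop_of_tendsto_deriv hd hpos
        (hFlim.inner hξlim)).eventually_gt_atTop 0)).exists
      linarith [hη t ht]

theorem IsSolution.oscillates_of_pos (hF : ContDiffOn ℝ ∞ F (Metric.closedBall 0 1))
    (h : IsSolution L F c) (he : IsEscaping F (c 0).2.2.1.1) (hη0 : 0 < (c 0).2.2.1.2) :
    Oscillates c := by
  obtain ⟨t, ht, htη⟩ := h.exists_eta_neg hF he
  obtain ⟨s, hs, hsη⟩ := h.reverse.exists_eta_neg hF.neg (by simpa using he.neg)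
  exact ⟨-s, 0, t, by linarith, ht, mul_neg_of_neg_of_pos hsη hη0, mul_neg_of_pos_of_neg hη0 htη⟩

theorem IsSolution.oscillates (hF : ContDiffOn ℝ ∞ F (Metric.closedBall 0 1))
    (h : IsSolution L F c) (he : IsEscaping F (c 0).2.2.1.1) : Oscillates c := by
  have hη0 : (c 0).2.2.1.2 ≠ 0 := by
    intro h0
    have h1 := (c 0).2.2.2
    have h2 := he.1
    rw [mem_ball_zero_iff] at h2
    rw [h0] at h1
    nlinarith [norm_nonneg (c 0).2.2.1.1]
  rcases hη0.lt_or_gt with hneg | hpos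
  · obtain ⟨t₁, t₂, t₃, h12, h23, h1, h2⟩ := (h.reflect 0).oscillates_of_pos hF
      (by simpa [UnitSphere.flip] using he) (by simpa [UnitSphere.flip] using hneg)
    refine ⟨-t₃, -t₂, -t₁, by linarith, by linarith, ?_, ?_⟩
    · simpa [UnitSphere.flip, mul_comm] using h2
    · simpa [UnitSphere.flip, mul_comm] using h1
  · exact h.oscillates_of_pos hF he hpos

end LF

namespace LF

open Set Filter Topology

/-! ### Smoothness of solutions -/

theorem contDiff_succ_of_hasDerivAt {V : Type*} [NormedAddCommGroup V] [NormedSpace ℝ V]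
    {f f' : ℝ → V} (h : ∀ t, HasDerivAt f (f' t) t) {n : ℕ} (hf' : ContDiff ℝ n f') :
    ContDiff ℝ (n + 1 : ℕ) f := by
  push_cast
  refine contDiff_succ_iff_deriv.2 ⟨fun t => (h t).differentiableAt, by simp, ?_⟩
  rwa [funext fun t => (h t).deriv]

theorem contDiff_infty_of_hasDerivAt {V : Type*} [NormedAddCommGroup V] [NormedSpace ℝ V]
    {f f' : ℝ → V} (h : ∀ t, HasDerivAt f (f' t) t) (hf' : ContDiff ℝ ∞ f') :
    ContDiff ℝ ∞ f := by
  refine contDiff_infty_iff_deriv.2 ⟨fun t => (h t).differentiableAt, ?_⟩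
  rwa [funext fun t => (h t).deriv]

variable {E : Type*} [NormedAddCommGroup E] [InnerProductSpace ℝ E]
  {L : E →L[ℝ] E} {F : E → E} {c : ℝ → SG E}

theorem IsSolution.contDiff_sphere (hF : ContDiffOn ℝ ∞ F (Metric.closedBall 0 1))
    (h : IsSolution L F c) : ContDiff ℝ ∞ fun t => ((c t).2.2 : E × ℝ) := by
  refine contDiff_infty.2 fun n => ?_
  induction n with
  | zero =>
    exact contDiff_zero.2 (continuous_subtype_val.comp (_root_.continuous_snd.comp h.continuous_snd))
  | succ n ih =>
    refine contDiff_succ_of_hasDerivAt h.hasDerivAt_sphere ?_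
    refine ((contDiffOn_sphereField hF).of_le ?_).comp_contDiff ih fun t => ?_
    · exact_mod_cast le_top
    · simpa using UnitSphere.norm_le _

theorem IsSolution.contDiff (hF : ContDiffOn ℝ ∞ F (Metric.closedBall 0 1)) [CompleteSpace E]
    (h : IsSolution L F c) :
    ContDiff ℝ ∞ fun t => ((c t).1, (c t).2.1, ((c t).2.2 : E × ℝ)) := by
  have hs := h.contDiff_sphere hF
  have hu : ContDiff ℝ ∞ fun t => (c t).2.1 := contDiff_infty_of_hasDerivAt h.deriv_u hs.snd
  have hw : ContDiff ℝ ∞ fun t => (c t).1 := contDiff_infty_of_hasDerivAt h.deriv_w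
    ((contDiff_exp_clm.comp (hu.smul contDiff_const)).clm_apply hs.fst)
  exact hw.prodMk (hu.prodMk hs)

/-- A solution which is at rest at one time, apart from the coordinate `w`, is so forever. -/
theorem IsSolution.snd_eq_of_stationary [FiniteDimensional ℝ E]
    (hF : ContDiffOn ℝ ∞ F (Metric.closedBall 0 1)) (h : IsSolution L F c) {t₀ : ℝ}
    (h₁ : (c t₀).2.2.1.2 = 0) (h₂ : inner ℝ (F (c t₀).2.2.1.1) (c t₀).2.2.1.1 = 0) (t : ℝ) :
    (c t).2 = (c t₀).2 := by
  have hc : IsSolution L F fun s =>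
      (s • NormedSpace.exp ((c t₀).2.1 • L) (c t₀).2.2.1.1, (c t₀).2) :=
    { deriv_xi := fun t => by simpa [h₁] using hasDerivAt_const t _
      deriv_eta := fun t => by simpa [h₂] using hasDerivAt_const t _
      deriv_w := fun t => by simpa using (hasDerivAt_id t).smul_const _
      deriv_u := fun t => by simpa [h₁] using hasDerivAt_const t _ }
  exact h.snd_unique hF hc (t₀ := t₀) rfl t

/-! ### Tori -/

theorem isOpenQuotientMap_toTorus (k : ℕ) : IsOpenQuotientMap (toTorus : (Fin k → ℝ) → Torus k) :=
  IsOpenQuotientMap.piMap fun _ => QuotientAddGroup.isOpenQuotientMap_mk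

theorem toTorus_eq_iff {k : ℕ} {x y : Fin k → ℝ} :
    toTorus x = toTorus y ↔ ∀ i, ∃ m : ℤ, y i = x i + m := by
  refine funext_iff.trans (forall_congr' fun i => ?_)
  refine QuotientAddGroup.eq.trans (AddSubgroup.mem_zmultiples_iff.trans (exists_congr fun m => ?_))
  simp only [zsmul_eq_mul, mul_one]
  constructor <;> intro h <;> linarith

theorem exists_lattice_basis [FiniteDimensional ℝ E] (Γ₀ : Submodule ℤ E) [DiscreteTopology Γ₀]
    [IsZLattice ℝ Γ₀] :
    ∃ b : Module.Basis (Fin (Module.finrank ℝ E)) ℝ E, Submodule.span ℤ (range b) = Γ₀ := by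
  have := ZLattice.module_free ℝ Γ₀
  have := ZLattice.module_finite ℝ Γ₀
  let b₀ := Module.finBasisOfFinrankEq ℤ Γ₀ (ZLattice.rank ℝ Γ₀)
  exact ⟨b₀.ofZLatticeBasis ℝ Γ₀, b₀.ofZLatticeBasis_span ℝ⟩

variable {Γ₀ : Submodule ℤ E}

omit [InnerProductSpace ℝ E] in
theorem continuous_proj : Continuous (proj Γ₀) := by
  unfold proj
  exact (continuous_quotient_mk'.comp continuous_fst).prodMk
    ((continuous_fst.comp continuous_snd).prodMk (continuous_snd.comp continuous_snd))

omit [InnerProductSpace ℝ E] in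
theorem proj_surjective : Function.Surjective (proj Γ₀) := by
  rintro ⟨w, q⟩
  obtain ⟨w, rfl⟩ := QuotientAddGroup.mk_surjective w
  exact ⟨(w, q), rfl⟩

theorem IsLFSystem.apply_proj [FiniteDimensional ℝ E] {Ψ : Flow ℝ (SM Γ₀)}
    (hΨ : IsLFSystem L F Ψ) (hF : ContDiffOn ℝ ∞ F (Metric.closedBall 0 1))
    (h : IsSolution L F c) (t : ℝ) : Ψ t (proj Γ₀ (c 0)) = proj Γ₀ (c t) := by
  obtain ⟨c', h', h0, hΨ'⟩ := hΨ (c 0)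
  rw [hΨ', h'.unique hF h h0]

/-- The product of `E / Γ₀` with the path of the base point `(u; ξ, η)` of the curve `c`. -/
def orbitTorus (Γ₀ : Submodule ℤ E) (c : ℝ → SG E) : Set (SM Γ₀) :=
  range fun p : E × ℝ => proj Γ₀ (p.1, (c p.2).2)

/-- A parametrization `ℝⁿ⁺¹ → SG` of the preimage of `orbitTorus Γ₀ c`. The first coordinate is the
time in units of the period `T`, the others are the coordinates of `w` with respect to the basis
`b`, after subtraction of the drift `Ω` of `w` per period. -/
noncomputable def torusLift {n : ℕ} (b : Module.Basis (Fin n) ℝ E) (c : ℝ → SG E) (T : ℝ) (Ω : E)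
    (x : Fin (n + 1) → ℝ) : SG E :=
  (∑ i, x i.succ • b i + ((c (T * x 0)).1 - x 0 • Ω), (c (T * x 0)).2)

section torusLift

variable {n : ℕ} {b : Module.Basis (Fin n) ℝ E} {T : ℝ} {Ω : E}

theorem proj_torusLift_eq_iff (hb : Submodule.span ℤ (range b) = Γ₀) (hT : 0 < T)
    (hper : ∀ s t, (c s).2 = (c t).2 ↔ ∃ k : ℤ, t = s + k * T)
    (hΩ : ∀ t, (c (t + T)).1 = (c t).1 + Ω) (x y : Fin (n + 1) → ℝ) :
    proj Γ₀ (torusLift b c T Ω x) = proj Γ₀ (torusLift b c T Ω y) ↔ toTorus x = toTorus y := by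
  have hG : Function.Periodic (fun τ => (c (T * τ)).1 - τ • Ω) 1 := fun τ => by
    simp only [mul_add, mul_one, hΩ, add_smul, one_smul]
    abel
  have hlat : ∑ i, y i.succ • b i - ∑ i, x i.succ • b i ∈ Γ₀ ↔
      ∀ i : Fin n, ∃ m : ℤ, y i.succ = x i.succ + m := by
    rw [← hb, b.mem_span_iff_repr_mem ℤ, ← Finset.sum_sub_distrib]
    simp_rw [← sub_smul, b.repr_sum_self]
    refine forall_congr' fun i => exists_congr fun m => ?_
    simp only [algebraMap_int_eq, eq_intCast]
    constructor <;> intro h <;> linarith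
  have htime : (c (T * x 0)).2 = (c (T * y 0)).2 ↔ ∃ m : ℤ, y 0 = x 0 + m := by
    refine (hper _ _).trans (exists_congr fun k => ?_)
    rw [show T * x 0 + k * T = T * (x 0 + k) by ring, mul_right_inj' hT.ne']
  rw [proj_eq_iff, toTorus_eq_iff, Fin.forall_fin_succ, ← htime, ← hlat]
  have hGeq : (c (T * x 0)).2 = (c (T * y 0)).2 →
      (c (T * y 0)).1 - y 0 • Ω = (c (T * x 0)).1 - x 0 • Ω := by
    intro h
    obtain ⟨m, hm⟩ := htime.1 h
    have := hG.int_mul m (x 0)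
    simpa [hm] using this
  constructor
  · rintro ⟨γ, hγ, h⟩
    have h2 : (c (T * x 0)).2 = (c (T * y 0)).2 := (congrArg Prod.snd h).symm
    refine ⟨h2, ?_⟩
    have h1 := congrArg Prod.fst h
    simp only [torusLift, hGeq h2] at h1
    have : ∑ i, y i.succ • b i - ∑ i, x i.succ • b i = γ := by
      rw [sub_eq_iff_eq_add, ← add_left_inj ((c (T * x 0)).1 - x 0 • Ω), h1]
      abel
    rwa [this]
  · rintro ⟨h2, hγ⟩
    refine ⟨_, hγ, Prod.ext ?_ h2.symm⟩
    simp only [torusLift, hGeq h2]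
    abel

theorem range_proj_torusLift (Γ₀ : Submodule ℤ E) (hT : 0 < T) :
    range (fun x => proj Γ₀ (torusLift b c T Ω x)) = orbitTorus Γ₀ c := by
  ext q
  constructor
  · rintro ⟨x, rfl⟩
    exact ⟨((torusLift b c T Ω x).1, T * x 0), rfl⟩
  · rintro ⟨⟨w, t⟩, rfl⟩
    refine ⟨Fin.cons (t / T) fun i => b.repr (w - ((c t).1 - (t / T) • Ω)) i, ?_⟩
    simp only [torusLift, Fin.cons_succ, Fin.cons_zero, b.sum_repr, mul_div_cancel₀ _ hT.ne',
      sub_add_cancel]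

theorem contDiff_torusLift (hF : ContDiffOn ℝ ∞ F (Metric.closedBall 0 1)) [CompleteSpace E]
    (h : IsSolution L F c) :
    ContDiff ℝ ∞ fun x => ((torusLift b c T Ω x).1, (torusLift b c T Ω x).2.1,
      ((torusLift b c T Ω x).2.2 : E × ℝ)) := by
  have hc := (h.contDiff hF).comp (contDiff_const.mul (contDiff_apply ℝ ℝ 0) :
    ContDiff ℝ ∞ fun x : Fin (n + 1) → ℝ => T * x 0)
  refine ContDiff.prodMk (.add (.sum fun i _ => (contDiff_apply ℝ ℝ _).smul contDiff_const)
    (hc.fst.sub ((contDiff_apply ℝ ℝ _).smul contDiff_const))) hc.snd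

theorem injective_fderiv_torusLift (hF : ContDiffOn ℝ ∞ F (Metric.closedBall 0 1))
    [FiniteDimensional ℝ E] (h : IsSolution L F c) (hT : 0 < T)
    (hper : ∀ s t, (c s).2 = (c t).2 ↔ ∃ k : ℤ, t = s + k * T) (x : Fin (n + 1) → ℝ) :
    Function.Injective (fderiv ℝ (fun x => ((torusLift b c T Ω x).1, (torusLift b c T Ω x).2.1,
      ((torusLift b c T Ω x).2.2 : E × ℝ))) x) := by
  set A : (Fin (n + 1) → ℝ) →L[ℝ] E :=
    ∑ i : Fin n, (ContinuousLinearMap.proj (R := ℝ) (φ := fun _ => ℝ) i.succ).smulRight (b i)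
  have hA : ∀ y, A y = ∑ i : Fin n, y i.succ • b i := fun y => by simp [A]
  set P : (Fin (n + 1) → ℝ) →L[ℝ] ℝ := ContinuousLinearMap.proj (R := ℝ) (φ := fun _ => ℝ) 0
  have hP : HasFDerivAt (fun y : Fin (n + 1) → ℝ => T * y 0) (T • P) x :=
    P.hasFDerivAt.const_mul T
  have hw := (h.deriv_w (T * x 0)).hasFDerivAt.comp x hP
  have hu := (h.deriv_u (T * x 0)).comp_hasFDerivAt x hP
  have hv := (h.hasDerivAt_sphere (T * x 0)).hasFDerivAt.comp x hP
  have hf := (A.hasFDerivAt (x := x)).add (hw.sub (P.hasFDerivAt.smul_const Ω)) |>.prodMk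
    (hu.prodMk hv)
  have hf' : HasFDerivAt (fun x => ((torusLift b c T Ω x).1, (torusLift b c T Ω x).2.1,
      ((torusLift b c T Ω x).2.2 : E × ℝ))) _ x := hf.congr_of_eventuallyEq
    (Eventually.of_forall fun y => by simp [torusLift, hA, P])
  rw [hf'.fderiv, injective_iff_map_eq_zero]
  intro y hy
  have hy0 : y 0 = 0 := by
    by_contra hne
    have hTy : T * y 0 ≠ 0 := mul_ne_zero hT.ne' hne
    have hη : (c (T * x 0)).2.2.1.2 = 0 := by
      have := congrArg (fun p => p.2.1) hy
      simpa [P, hT.ne', hne] using this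
    have hη' : inner ℝ (F (c (T * x 0)).2.2.1.1) (c (T * x 0)).2.2.1.1 = 0 := by
      have := congrArg (fun p => p.2.2.2) hy
      simpa [P, hT.ne', hne, sphereField] using this
    have hconst := h.snd_eq_of_stationary hF hη hη'
    obtain ⟨k, hk⟩ := (hper 0 (T / 2)).1 ((hconst _).trans (hconst _).symm)
    have h2 : (1 : ℝ) = 2 * k := by
      have : T * 1 = T * (2 * k) := by linarith
      exact mul_left_cancel₀ hT.ne' this
    have h3 : (1 : ℤ) = 2 * k := by exact_mod_cast h2
    omega
  have hAy : ∑ i : Fin n, y i.succ • b i = 0 := by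
    have := congrArg (fun p => p.1) hy
    simpa [P, hy0, hA] using this
  funext i
  refine Fin.cases hy0 (fun i => ?_) i
  exact Fintype.linearIndependent_iff.1 b.linearIndependent _ hAy i

end torusLift

/-- An oscillating orbit lies on an invariant torus with quasi-periodic motion: with the period
`T` and the drift `Ω` of `w` per period, the frequencies are `1 / T` and the coordinates of
`Ω / T`. -/
theorem Oscillates.isQuasiPeriodicTorus [FiniteDimensional ℝ E] [DiscreteTopology Γ₀]
    [IsZLattice ℝ Γ₀] {Ψ : Flow ℝ (SM Γ₀)} (ho : Oscillates c) (hΨ : IsLFSystem L F Ψ)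
    (hF : ContDiffOn ℝ ∞ F (Metric.closedBall 0 1)) (h : IsSolution L F c) :
    IsQuasiPeriodicTorus Ψ (orbitTorus Γ₀ c) := by
  have := FiniteDimensional.complete ℝ E
  obtain ⟨T, hT, hper⟩ := ho.exists_period hF h
  obtain ⟨b, hb⟩ := exists_lattice_basis Γ₀
  obtain ⟨Ω, hΩ⟩ : ∃ Ω : E, ∀ t, (c (t + T)).1 = (c t).1 + Ω := by
    refine ⟨(c (0 + T)).1 - (c 0).1, fun t => ?_⟩
    rw [← (h.comp_add T).fst_sub_eq h (fun t => ((hper _ _).2 ⟨1, by simp⟩).symm) 0 t]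
    abel
  have hsurj := (isOpenQuotientMap_toTorus (Module.finrank ℝ E + 1)).surjective
  have hiff := proj_torusLift_eq_iff hb hT hper hΩ
  set φ : Torus (Module.finrank ℝ E + 1) → SM Γ₀ := fun θ =>
    proj Γ₀ (torusLift b c T Ω (Function.surjInv hsurj θ)) with hφdef
  have hφ : ∀ x, φ (toTorus x) = proj Γ₀ (torusLift b c T Ω x) := fun x =>
    (hiff _ _).2 (Function.surjInv_eq hsurj _)
  have hcd := contDiff_torusLift (b := b) (T := T) (Ω := Ω) hF h
  have hcont : Continuous φ := by
    rw [(isOpenQuotientMap_toTorus _).isQuotientMap.continuous_iff,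
      show φ ∘ toTorus = fun x => proj Γ₀ (torusLift b c T Ω x) from funext hφ]
    refine continuous_proj.comp (hcd.continuous.fst.prodMk (hcd.continuous.snd.fst.prodMk ?_))
    exact hcd.continuous.snd.snd.subtype_mk _
  have hinj : Function.Injective φ := by
    intro θ θ' hθ
    obtain ⟨x, rfl⟩ := hsurj θ
    obtain ⟨y, rfl⟩ := hsurj θ'
    rwa [hφ, hφ, hiff] at hθ
  have hclosed : IsClosed (Γ₀.toAddSubgroup : Set E) :=
    @AddSubgroup.isClosed_of_discrete E _ _ _ _ Γ₀.toAddSubgroup ‹DiscreteTopology Γ₀›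
  let freq : Fin (Module.finrank ℝ E + 1) → ℝ := Fin.cons T⁻¹ fun i => b.repr (T⁻¹ • Ω) i
  refine ⟨φ, freq,
    ⟨(hcont.isClosedEmbedding hinj).isEmbedding, torusLift b c T Ω, fun x => (hφ x).symm, hcd,
      injective_fderiv_torusLift hF h hT hper⟩, ?_, ?_, ?_⟩
  · rw [← range_proj_torusLift (b := b) (Ω := Ω) Γ₀ hT, ← hsurj.range_comp φ]
    exact congrArg range (funext hφ)
  · intro h0
    exact hT.ne' (inv_eq_zero.1 (congrFun h0 0))
  · intro t θ
    obtain ⟨x, rfl⟩ := hsurj θ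
    have hd := (h.comp_add (T * x 0)).const_add (∑ i, x i.succ • b i - x 0 • Ω)
    have h1 := hΨ.apply_proj hF hd t
    have h2 : torusLift b c T Ω x = (∑ i, x i.succ • b i - x 0 • Ω + (c (0 + T * x 0)).1,
        (c (0 + T * x 0)).2) := by
      rw [zero_add]
      exact Prod.ext (by simp only [torusLift]; abel) rfl
    rw [hφ, h2, h1]
    refine Eq.trans (congrArg (proj Γ₀) (Prod.ext ?_ ?_)) (hφ (x + t • freq)).symm
    all_goals
      have h3 : T * (x + t • freq) 0 = t + T * x 0 := by
        simp only [freq, Pi.add_apply, Pi.smul_apply, Fin.cons_zero, smul_eq_mul]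
        field_simp
        ring
    · have h4 : ∑ i : Fin _, (t * b.repr (T⁻¹ • Ω) i) • b i = (t * T⁻¹) • Ω := by
        simp_rw [mul_smul, ← Finset.smul_sum, b.sum_repr]
      simp only [torusLift, h3]
      simp only [freq, Pi.add_apply, Pi.smul_apply, Fin.cons_zero, Fin.cons_succ, smul_eq_mul,
        add_smul, Finset.sum_add_distrib, h4]
      abel
    · simp only [torusLift, h3]

end LF

namespace LF

open Set Filter Topology

/-! ### The flow on `SM` and the union of the tori -/

variable {E : Type*} [NormedAddCommGroup E] [InnerProductSpace ℝ E] [FiniteDimensional ℝ E]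
  {L : E →L[ℝ] E} {F : E → E} {Γ₀ : Submodule ℤ E}

theorem existsUnique_isLFSystem (hF : ContDiffOn ℝ ∞ F (Metric.closedBall 0 1)) :
    ∃! Ψ : Flow ℝ (SM Γ₀), IsLFSystem L F Ψ := by
  obtain ⟨W, R, hW, hR, hW0, hR0, hsol⟩ := exists_solutions L hF
  let ψ : ℝ → SM Γ₀ → SM Γ₀ := fun t x => (x.1 + QuotientAddGroup.mk (W (x.2, t)), R (x.2, t))
  have hψ : ∀ t p, ψ t (proj Γ₀ p) = proj Γ₀ (p.1 + W (p.2, t), R (p.2, t)) := fun _ _ => rfl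
  have hzero : ∀ p : SG E, (p.1 + W (p.2, 0), R (p.2, 0)) = p := fun p => by rw [hW0, hR0, add_zero]
  refine ⟨⟨ψ, ?_, fun s t x => ?_, fun x => ?_⟩, fun p => ⟨_, hsol p, hzero p, fun t => hψ t p⟩,
    fun Ψ hΨ => Flow.ext fun t x => ?_⟩
  · have hpair : Continuous fun q : ℝ × SM Γ₀ => (q.2.2, q.1) := by fun_prop
    have hmk : Continuous fun q : ℝ × SM Γ₀ =>
        (QuotientAddGroup.mk (W (q.2.2, q.1)) : E ⧸ Γ₀.toAddSubgroup) :=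
      continuous_quotient_mk'.comp (hW.comp hpair)
    exact ((continuous_fst.comp continuous_snd).add hmk).prodMk (hR.comp hpair)
  · obtain ⟨p, rfl⟩ := proj_surjective x
    have h := ((hsol p).comp_add t).unique hF (hsol (p.1 + W (p.2, t), R (p.2, t))) (t₀ := 0)
      (by simp [hW0, hR0]) s
    simp only [hψ, h]
  · obtain ⟨p, rfl⟩ := proj_surjective x
    rw [hψ, hzero]
  · obtain ⟨p, rfl⟩ := proj_surjective x
    have h := hΨ.apply_proj hF (hsol p) t
    rw [hzero] at h
    exact h.trans (hψ t p).symm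

/-- The set of the points of `SM` whose base point `(u; ξ, η)` lies on the path of an oscillating
solution; it is the union of the corresponding tori. -/
def oscillatingSet (Γ₀ : Submodule ℤ E) (L : E →L[ℝ] E) (F : E → E) : Set (SM Γ₀) :=
  {x | ∃ c, IsSolution L F c ∧ Oscillates c ∧ (c 0).2 = x.2}

theorem isOpen_oscillatingSet (hF : ContDiffOn ℝ ∞ F (Metric.closedBall 0 1)) :
    IsOpen (oscillatingSet Γ₀ L F) := by
  obtain ⟨W, R, hW, hR, hW0, hR0, hsol⟩ := exists_solutions L hF
  have heq : oscillatingSet Γ₀ L F =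
      ⋃ (t₁ : ℝ) (t₂ : ℝ) (t₃ : ℝ) (_ : t₁ < t₂) (_ : t₂ < t₃),
        {x | (R (x.2, t₁)).2.1.2 * (R (x.2, t₂)).2.1.2 < 0} ∩
        {x | (R (x.2, t₂)).2.1.2 * (R (x.2, t₃)).2.1.2 < 0} := by
    ext x
    simp only [mem_iUnion, exists_prop]
    constructor
    · rintro ⟨c, hc, ⟨t₁, t₂, t₃, h12, h23, h1, h2⟩, h0⟩
      have h := hc.snd_unique hF (hsol (0, x.2)) (t₀ := 0) (by simp only [h0, hR0])
      simp only [h] at h1 h2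
      exact ⟨t₁, t₂, t₃, h12, h23, h1, h2⟩
    · rintro ⟨t₁, t₂, t₃, h12, h23, h1, h2⟩
      exact ⟨_, hsol (0, x.2), ⟨t₁, t₂, t₃, h12, h23, h1, h2⟩, hR0 _⟩
  have hcont : ∀ t, Continuous fun x : SM Γ₀ => (R (x.2, t)).2.1.2 := fun t =>
    continuous_snd.comp (continuous_subtype_val.comp (continuous_snd.comp
      (hR.comp (continuous_snd.prodMk continuous_const))))
  rw [heq]
  exact isOpen_iUnion fun t₁ => isOpen_iUnion fun t₂ => isOpen_iUnion fun t₃ =>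
    isOpen_iUnion fun _ => isOpen_iUnion fun _ =>
      (isOpen_lt ((hcont t₁).mul (hcont t₂)) continuous_const).inter
        (isOpen_lt ((hcont t₂).mul (hcont t₃)) continuous_const)

theorem isFilledWithTori_oscillatingSet [DiscreteTopology Γ₀] [IsZLattice ℝ Γ₀]
    {Ψ : Flow ℝ (SM Γ₀)} (hΨ : IsLFSystem L F Ψ)
    (hF : ContDiffOn ℝ ∞ F (Metric.closedBall 0 1)) :
    IsFilledWithTori Ψ (oscillatingSet Γ₀ L F) := by
  refine ⟨{T | ∃ c, IsSolution L F c ∧ Oscillates c ∧ orbitTorus Γ₀ c = T}, ?_, ?_, ?_⟩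
  · rintro _ ⟨c, hc, ho, rfl⟩
    exact ho.isQuasiPeriodicTorus hΨ hF hc
  · -- two orbits of base points with a common point coincide
    have key : ∀ c c', IsSolution L F c → IsSolution L F c' → ∀ s t, (c s).2 = (c' t).2 →
        orbitTorus Γ₀ c ⊆ orbitTorus Γ₀ c' := by
      rintro c c' hc hc' s t hst _ ⟨⟨w, r⟩, rfl⟩
      refine ⟨(w, t + (r - s)), ?_⟩
      have := hc.snd_add_eq hF hc' hst (r - s)
      rw [add_sub_cancel] at this
      simp only [this]
    rintro _ ⟨c, hc, ho, rfl⟩ _ ⟨c', hc', ho', rfl⟩ hne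
    refine Set.disjoint_left.2 ?_
    rintro _ ⟨⟨w, s⟩, rfl⟩ ⟨⟨w', t⟩, h⟩
    have hst : (c s).2 = (c' t).2 := (congrArg Prod.snd h).symm
    exact hne ((key c c' hc hc' s t hst).antisymm (key c' c hc' hc t s hst.symm))
  · ext x
    constructor
    · rintro ⟨_, ⟨c, hc, ho, rfl⟩, ⟨⟨w, t⟩, rfl⟩⟩
      exact ⟨_, hc.comp_add t, ho.comp_add t, by simp [proj]⟩
    · rintro ⟨c, hc, ho, h0⟩
      obtain ⟨⟨w, q⟩, rfl⟩ := proj_surjective x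
      refine ⟨_, ⟨c, hc, ho, rfl⟩, ⟨(w, 0), ?_⟩⟩
      simp only [h0]
      rfl

theorem mem_oscillatingSet (hF : ContDiffOn ℝ ∞ F (Metric.closedBall 0 1)) {x : SM Γ₀}
    (hx : IsEscaping F x.2.2.1.1) : x ∈ oscillatingSet Γ₀ L F := by
  obtain ⟨W, R, hW, hR, hW0, hR0, hsol⟩ := exists_solutions L hF
  have h0 : R (x.2, 0) = x.2 := hR0 _
  exact ⟨_, hsol (0, x.2), (hsol (0, x.2)).oscillates hF (by simpa only [h0] using hx), h0⟩

omit [InnerProductSpace ℝ E] [FiniteDimensional ℝ E] in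
/-- Each of the two hemispheres is a graph over the closed ball. -/
theorem exists_section (v : UnitSphere E) :
    ∃ σ : Metric.closedBall (0 : E) 1 → UnitSphere E, Continuous σ ∧ (∀ x, (σ x).1.1 = x) ∧
      σ ⟨v.1.1, v.fst_mem⟩ = v := by
  have hsq : ∀ x : Metric.closedBall (0 : E) 1, 0 ≤ 1 - ‖(x : E)‖ ^ 2 := fun x => by
    have := mem_closedBall_zero_iff.1 x.2
    nlinarith [norm_nonneg (x : E)]
  have hcont : Continuous fun x : Metric.closedBall (0 : E) 1 => √(1 - ‖(x : E)‖ ^ 2) := by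
    fun_prop
  have hv : 1 - ‖v.1.1‖ ^ 2 = v.1.2 ^ 2 := by linarith [v.2]
  rcases le_total 0 v.1.2 with h | h
  · refine ⟨fun x => ⟨(x, √(1 - ‖(x : E)‖ ^ 2)), by simp [Real.sq_sqrt (hsq x)]⟩,
      by
        refine Continuous.subtype_mk ?_ _
        exact continuous_subtype_val.prodMk hcont, fun _ => rfl, ?_⟩
    exact Subtype.ext (Prod.ext rfl (by simp [hv, Real.sqrt_sq h]))
  · refine ⟨fun x => ⟨(x, -√(1 - ‖(x : E)‖ ^ 2)), by simp [Real.sq_sqrt (hsq x)]⟩,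
      by
        refine Continuous.subtype_mk ?_ _
        exact continuous_subtype_val.prodMk hcont.neg, fun _ => rfl, ?_⟩
    exact Subtype.ext (Prod.ext rfl (by simp [hv, Real.sqrt_sq_eq_abs, abs_of_nonpos h]))

theorem dense_oscillatingSet (hF : ContDiffOn ℝ ∞ F (Metric.closedBall 0 1))
    (hd : Metric.ball 0 1 ⊆ closure {ζ | IsEscaping F ζ}) : Dense (oscillatingSet Γ₀ L F) := by
  have hd' : Metric.closedBall (0 : E) 1 ⊆ closure {ζ | IsEscaping F ζ} := by
    rw [← closure_ball (0 : E) one_ne_zero]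
    exact closure_minimal hd isClosed_closure
  have hdense : Dense {x : Metric.closedBall (0 : E) 1 | IsEscaping F x} := by
    intro x
    rw [closure_subtype]
    refine closure_mono ?_ (hd' x.2)
    exact fun ζ hζ => ⟨⟨ζ, Metric.ball_subset_closedBall hζ.1⟩, hζ, rfl⟩
  rintro ⟨w, u, v⟩
  obtain ⟨σ, hσ, hσ1, hσv⟩ := exists_section v
  have hmaps : MapsTo (fun x => ((w, u, σ x) : SM Γ₀))
      {x : Metric.closedBall (0 : E) 1 | IsEscaping F x} (oscillatingSet Γ₀ L F) := fun x hx =>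
    mem_oscillatingSet hF (by simpa [hσ1] using hx)
  have := map_mem_closure (continuous_const.prodMk (continuous_const.prodMk hσ))
    (hdense ⟨v.1.1, v.fst_mem⟩) hmaps
  rwa [hσv] at this

end LF

theorem theorem6p1 {E : Type*} [NormedAddCommGroup E] [InnerProductSpace ℝ E]
    [FiniteDimensional ℝ E]
    (Γ₀ : Submodule ℤ E) [DiscreteTopology Γ₀] [IsZLattice ℝ Γ₀]
    (L : E →L[ℝ] E) (F : E → E) (hF : ContDiffOn ℝ ∞ F (Metric.closedBall 0 1)) :
    (∃! Ψ : Flow ℝ (LF.SM Γ₀), LF.IsLFSystem L F Ψ) ∧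
    ∀ Ψ : Flow ℝ (LF.SM Γ₀), LF.IsLFSystem L F Ψ →
      ((∃ ζ, LF.IsEscaping F ζ) → LF.SemiIntegrable Ψ) ∧
      (Metric.ball 0 1 ⊆ closure {ζ | LF.IsEscaping F ζ} → LF.Integrable Ψ) := by
  refine ⟨LF.existsUnique_isLFSystem hF, fun Ψ hΨ => ⟨?_, fun hd => ?_⟩⟩
  · rintro ⟨ζ, hζ⟩
    have hsq : 0 ≤ 1 - ‖ζ‖ ^ 2 := by
      have := mem_ball_zero_iff.1 hζ.1
      nlinarith [norm_nonneg ζ]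
    let v : LF.UnitSphere E := ⟨(ζ, √(1 - ‖ζ‖ ^ 2)), by simp [Real.sq_sqrt hsq]⟩
    exact ⟨LF.oscillatingSet Γ₀ L F, LF.isOpen_oscillatingSet hF,
      ⟨(0, 0, v), LF.mem_oscillatingSet hF hζ⟩, LF.isFilledWithTori_oscillatingSet hΨ hF⟩
  · exact ⟨LF.oscillatingSet Γ₀ L F, LF.isOpen_oscillatingSet hF, LF.dense_oscillatingSet hF hd,
      LF.isFilledWithTori_oscillatingSet hΨ hF⟩
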